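/- Identify the unit circle $\mathbb S$ with $\mathbb R/\mathbb Z$ (total length $1$) and let $\sigma_2(x)=2x$. A chord $\ell=ab$ may be degenerate ($a=b$); $\sigma_2(ab)=\sigma_2(a)\sigma_2(b)$, the chord $-\ell$ is the image of $\ell$ under $x\mapsto x+\frac12$, and $|\ell|$ is the length of the shorter circle arc joining the endpoints of $\ell$. A lamination is a set of chords (leaves), no two of which cross in the open disk, that contains all points of $\mathbb S$ and is closed under limits. A lamination $\mathcal L$ is quadratic if for every $\ell\in\mathcal L$ we have $\sigma_2(\ell)\in\mathcal L$, $-\ell\in\mathcal L$, and $\ell=\sigma_2(\ell_1)$ for some $\ell_1\in\mathcal L$. A major of $\mathcal L$ is a longest leaf of $\mathcal L$, the minor of $\mathcal L$ is the $\sigma_2$-image of a major, and $\mathrm{QML}$ is the set of the minors of all quadratic laminations. A q-lamination consists of all singletons in $\mathbb S$ and all edges of the convex hulls of the classes of an equivalence relation on $\mathbb S$ that has closed graph and finite classes, whose distinct classes have disjoint convex hulls, and for which $\sigma_2$ maps each class onto a class. A chord $m$ is periodic if $\sigma_2^n(m)=m$ for some $n>0$. For a non-degenerate minor $m$, let $\mathcal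 L(m)$ be the greatest quadratic lamination with minor $m$ if $m$ is not periodic, and the unique q-lamination with minor $m$ if $m$ is periodic. For a non-degenerate chord $\ell$ that is not a diameter, let $H(\ell)$ be the shorter open arc bounded by its endpoints. For a point $a$, write $a<\ell$ if $a\in H(\ell)$, and say that $a$ lies behind $\ell$ if $a\in\overline{H(\ell)}$; for a chord $\ell_1$, write $\ell_1\le\ell$ if both endpoints of $\ell_1$ lie in $\overline{H(\ell)}$. Let $m\in\mathrm{QML}$ be non-degenerate. Suppose that a point $a\in\mathbb S$ lies behind $m$, that $\sigma_2^n(a)$ is an endpoint of $m$ for some $n>0$, and that there is some $k$ for which $\sigma_2^k(a)$ is an endpoint of a minor $m'$ with $a<m'\le m$. Let $l$ be the least such $k$ (necessarily $l>0$), and let $m'$ be any minor with $a<m'\le m$ that has $\sigma_2^l(a)$ as an endpoint. A leaf $m_a\in\mathcal L(m')$ that has $a$ as an endpoint, satisfies $\sigma_2^l(m_a)=m'$, and is such that $\sigma_2^{l-1}(m_a)$ is a major of $\mathcal L(m')$ is called an offspring of $m$. **Theorem A.** Let $m\in\mathrm{QML}$ be a non-degenerate minor. 1. Every offspring of $m$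 belongs to $\mathrm{QML}$. 2. If a point $a\in\mathbb S$ lies behind $m$ and $\sigma_2^n(a)$ is an endpoint of $m$ for some $n\ge 0$, then there are a minor $m_a\in\mathrm{QML}$ that has $a$ as an endpoint and a $k\ge 0$ with $\sigma_2^k(m_a)=m$. -/

import Mathlib

/-!
The unit circle is identified with `ℝ / ℤ` (`UnitAddCircle`, total length `1`), a point being
recorded by its angle. Chords are recorded by their unordered pairs of endpoints; a chord is
degenerate when its two endpoints coincide.
-/

namespace QuadLam

/-- The unit circle, parametrized by angles in `ℝ / ℤ`. -/
abbrev Circ : Type := UnitAddCircle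

/-- A (possibly degenerate) chord of the unit disk: the unordered pair of its endpoints. -/
abbrev Chord : Type := Sym2 Circ

/-- The angle doubling map `σ₂` on the circle. -/
def dbl (x : Circ) : Circ := x + x

/-- The action of `σ₂` on chords. -/
def dblChord (l : Chord) : Chord := l.map dbl

/-- The antipodal point: the angle is incremented by `1/2`. -/
noncomputable def antipode (x : Circ) : Circ := x + (((1 / 2 : ℝ)) : Circ)

/-- The sibling `-ℓ` of a chord `ℓ`: its image under the half-turn. -/
noncomputable def sibling (l : Chord) : Chord := l.map antipode

/-- The length of a chord: the length of the shorter circle arc joining its endpoints. -/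
noncomputable def chordLength (l : Chord) : ℝ :=
  Sym2.lift ⟨fun a b : Circ => dist a b, fun a b => dist_comm a b⟩ l

/-- Two chords cross (are linked): they meet inside the open disk and are distinct. In terms of
endpoints, those of the second chord lie in the two different open arcs cut out by the first. -/
def Linked (l l' : Chord) : Prop :=
  ∃ a b c d : Circ, l = s(a, b) ∧ l' = s(c, d) ∧ sbtw a c b ∧ sbtw b d a

/-- A (geodesic) lamination: a set of pairwise unlinked chords that contains all points of the
circle and is closed under limits. -/
structure IsLamination (L : Set Chord) : Prop where
  unlinked : ∀ l ∈ L, ∀ l' ∈ L, ¬ Linked l l'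
  points : ∀ x : Circ, s(x, x) ∈ L
  closed : IsClosed {p : Circ × Circ | s(p.1, p.2) ∈ L}

/-- A quadratic invariant lamination. -/
structure IsQuadraticLamination (L : Set Chord) : Prop extends IsLamination L where
  forward : ∀ l ∈ L, dblChord l ∈ L
  backward : ∀ l ∈ L, ∃ l₁ ∈ L, dblChord l₁ = l
  sibling_mem : ∀ l ∈ L, sibling l ∈ L

/-- A major of `L`: a longest leaf of `L`. -/
def IsMajor (L : Set Chord) (M : Chord) : Prop :=
  M ∈ L ∧ ∀ l ∈ L, chordLength l ≤ chordLength M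

/-- A minor of `L`: the image of a major of `L`. -/
def IsMinorOf (L : Set Chord) (m : Chord) : Prop :=
  ∃ M, IsMajor L M ∧ dblChord M = m

/-- The quadratic minor lamination: the set of the minors of all quadratic laminations. -/
def QML : Set Chord :=
  {m | ∃ L : Set Chord, IsQuadraticLamination L ∧ IsMinorOf L m}

/-- An invariant laminational equivalence relation on the circle: the graph is closed, distinct
classes have disjoint convex hulls (no chord joining two points of one class crosses a chord
joining two points of another class), classes are finite, and `σ₂` maps classes onto classes. -/
structure IsInvariantLaminational (r : Setoid Circ) : Prop where
  closed : IsClosed {p : Circ × Circ | r p.1 p.2}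
  unlinked : ∀ x y z w : Circ, r x y → r z w → ¬ r x z → ¬ Linked s(x, y) s(z, w)
  finite : ∀ x : Circ, {y | r x y}.Finite
  image_class : ∀ x : Circ, dbl '' {y | r x y} = {y | r (dbl x) y}

/-- The lamination generated by an equivalence relation: all singletons, together with the edges of
the convex hulls of the classes, an edge being a chord joining two distinct points of a class such
that at least one of the two open arcs between them contains no point of that class. -/
def laminationOf (r : Setoid Circ) : Set Chord :=
  {l | ∃ x y : Circ, l = s(x, y) ∧ r x y ∧ (x = y ∨ ∀ z, r x z → ¬ sbtw x z y)}

/-- A quadratic q-lamination: generated by an invariant laminational equivalence relation. -/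
def IsQLamination (L : Set Chord) : Prop :=
  ∃ r : Setoid Circ, IsInvariantLaminational r ∧ L = laminationOf r

/-- A chord is periodic if some positive iterate of `σ₂` maps it to itself. -/
def IsPeriodicChord (m : Chord) : Prop := ∃ n : ℕ, 0 < n ∧ dblChord^[n] m = m

/-- `L` is the minor leaf lamination `L(m)` of the non-degenerate minor `m`: if `m` is not
periodic, the greatest quadratic lamination with minor `m`; if `m` is periodic, the q-lamination
with minor `m`. -/
def IsMinorLeafLamination (m : Chord) (L : Set Chord) : Prop :=
  (¬ IsPeriodicChord m ∧
      IsGreatest {L' : Set Chord | IsQuadraticLamination L' ∧ IsMinorOf L' m} L) ∨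
    (IsPeriodicChord m ∧ IsQLamination L ∧ IsMinorOf L m)

/-- The closure of `H(ℓ)`: the closed shorter arc bounded by the endpoints of `ℓ` (for a chord that
is not a diameter). A point lies on it iff its distances to the endpoints add up to `|ℓ|`. -/
def closedArc (l : Chord) : Set Circ :=
  {x | ∃ a b : Circ, l = s(a, b) ∧ dist a x + dist x b = dist a b}

/-- `H(ℓ)`: the open shorter arc bounded by the endpoints of `ℓ`. A point `a` lies strictly behind
`ℓ`, written `a < ℓ`, iff `a ∈ H(ℓ)`; it lies behind `ℓ` iff it is in the closed arc. -/
def openArc (l : Chord) : Set Circ := {x | x ∈ closedArc l ∧ x ∉ l}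

/-- `ℓ₁ ≤ ℓ`: the chord `ℓ₁` lies behind `ℓ`, that is, in the convex hull of the closed arc. -/
def Behind (l₁ l : Chord) : Prop := ∀ x ∈ l₁, x ∈ closedArc l

/-- `m'` is a minor that separates `a` from `m` or equals `m`, that is `a < m' ≤ m`, and
`σ₂ᵏ(a)` is an endpoint of `m'`. -/
def IsHitMinor (m : Chord) (a : Circ) (k : ℕ) (m' : Chord) : Prop :=
  m' ∈ QML ∧ a ∈ openArc m' ∧ Behind m' m ∧ dbl^[k] a ∈ m'

/-- `m₁` is an offspring of the non-degenerate minor `m` that contains the point `a`. Here `a` lies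
behind `m` and is mapped to an endpoint of `m` by some positive iterate of `σ₂`; `l + 1` is the
least `k` such that `σ₂ᵏ(a)` is an endpoint of a minor `m'` with `a < m' ≤ m`; and `m₁` is an
iterated pullback of such a minor `m'` in `L(m')` that contains `a` and goes through a major of
`L(m')`. The least `k` is never `0`, as `a < m'` excludes that `a` is an endpoint of `m'`. -/
def IsOffspringAt (m : Chord) (a : Circ) (m₁ : Chord) : Prop :=
  a ∈ closedArc m ∧ (∃ n : ℕ, 0 < n ∧ dbl^[n] a ∈ m) ∧
    ∃ (l : ℕ) (m' : Chord) (L : Set Chord),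
      IsLeast {k : ℕ | ∃ m'', IsHitMinor m a k m''} (l + 1) ∧
      IsHitMinor m a (l + 1) m' ∧
      IsMinorLeafLamination m' L ∧
      m₁ ∈ L ∧ a ∈ m₁ ∧ dblChord^[l + 1] m₁ = m' ∧ IsMajor L (dblChord^[l] m₁)

/-- `m₁` is an offspring of the non-degenerate minor `m`. -/
def IsOffspring (m m₁ : Chord) : Prop := ∃ a : Circ, IsOffspringAt m a m₁

end QuadLam

/-!
Let `L` be a family of pairwise unlinked chords, invariant under `σ₂` and siblings, with major `M`
and non-degenerate minor `m = σ₂(M)`. The majors `M`, `-M` cut the circle into two long and two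
short arcs, and by maximality of `|M|` every leaf has both ends in one of these four closed arcs.

Conversely, there is a criterion for minors (`mem_QML_of_tame`): if all images of a chord have
both ends in one of the four arcs cut out by its long preimages, and are pairwise unlinked, then
the chord is a minor. The quadratic lamination is the closure of the set of chords with tame orbit
that eventually land in the orbit of the chord. These are unlinked since `σ₂` keeps linked chords
in one arc linked, so that a crossing would be carried forward into the orbit.

Now let a leaf `c` of `L` lie behind `m`, with `σ₂ˡ(c) = M`. The criterion can fail for `c` in one
way only: some image of `c` lies in a short arc cut out by `M` and `-M` and joins the parts of it on
either side of the long preimages of `c`; the next image of `c` then separates `c` from `m`. Such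
images occur before `M` in the orbit, as all later ones are at least as long as `m`. So either `c` is a minor, or one of its images
before `M` is a minor that separates `c` from `m`
(`IsSiblingInvariant.mem_QML_or_exists_iterate`).

* For the existence of a minor at `a`, pull `m` back through a major along the orbit of `a`. If
  the pullback is not itself a minor, some image of it is a minor that `a` lies behind and that is
  mapped to `m`; the orbit of `a` reaches it earlier than it reaches `m`, and induction applies
  (`exists_minor_of_iterate_mem`).
* For an offspring `c` at `a`, a separating image `c' = σ₂ʲ(c)` would be a minor with `a < c' ≤ m`
  reached by `a` before the least such time. The remaining case that `a` is an end of `c'` is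
  excluded in `IsSiblingInvariant.not_mem_iterate`.

The lamination of a periodic minor is generated by an equivalence relation; that it is invariant
under `σ₂` and siblings is `IsInvariantLaminational.isSiblingInvariant`.
-/

namespace QuadLam

/-! ### Real coordinates on the circle -/

theorem coe_eq_coe_iff {s t : ℝ} : (s : Circ) = t ↔ ∃ n : ℤ, s = t + n := by
  rw [← sub_eq_zero, ← AddCircle.coe_sub, AddCircle.coe_eq_zero_iff]
  constructor
  · rintro ⟨n, hn⟩
    refine ⟨n, ?_⟩
    simp only [zsmul_eq_mul, mul_one] at hn
    linarith
  · rintro ⟨n, hn⟩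
    refine ⟨n, ?_⟩
    simp only [zsmul_eq_mul, mul_one]
    linarith

theorem coe_add_int (t : ℝ) (n : ℤ) : ((t + n : ℝ) : Circ) = t :=
  coe_eq_coe_iff.2 ⟨n, rfl⟩

theorem coe_add_one (t : ℝ) : ((t + 1 : ℝ) : Circ) = t :=
  coe_eq_coe_iff.2 ⟨1, by simp⟩

theorem exists_lift (u : ℝ) (p : Circ) : ∃ t : ℝ, u ≤ t ∧ t < u + 1 ∧ (t : Circ) = p := by
  obtain ⟨s, rfl⟩ := QuotientAddGroup.mk_surjective p
  refine ⟨s + (-⌊s - u⌋ : ℤ), ?_, ?_, coe_add_int _ _⟩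
  · have := Int.floor_le (s - u)
    push_cast
    linarith
  · have := Int.lt_floor_add_one (s - u)
    push_cast
    linarith

theorem dbl_coe (t : ℝ) : dbl (t : Circ) = ((2 * t : ℝ) : Circ) := by
  rw [dbl, ← AddCircle.coe_add, two_mul]

theorem antipode_coe (t : ℝ) : antipode (t : Circ) = ((t + 1 / 2 : ℝ) : Circ) := by
  rw [antipode, ← AddCircle.coe_add]

theorem antipode_antipode (p : Circ) : antipode (antipode p) = p := by
  obtain ⟨s, rfl⟩ := QuotientAddGroup.mk_surjective p
  rw [antipode_coe, antipode_coe]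
  exact coe_eq_coe_iff.2 ⟨1, by norm_num; ring⟩

theorem dbl_antipode (p : Circ) : dbl (antipode p) = dbl p := by
  obtain ⟨s, rfl⟩ := QuotientAddGroup.mk_surjective p
  rw [antipode_coe, dbl_coe, dbl_coe]
  exact coe_eq_coe_iff.2 ⟨1, by push_cast; ring⟩

theorem dbl_eq_dbl_iff {p q : Circ} : dbl p = dbl q ↔ p = q ∨ p = antipode q := by
  refine ⟨fun h => ?_, ?_⟩
  · obtain ⟨s, hs, hs', rfl⟩ := exists_lift 0 p
    obtain ⟨t, ht, ht', rfl⟩ := exists_lift 0 q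
    rw [dbl_coe, dbl_coe, coe_eq_coe_iff] at h
    obtain ⟨n, hn⟩ := h
    have h1 : ((-2 : ℤ) : ℝ) < n := by push_cast; linarith
    have h2 : (n : ℝ) < (2 : ℤ) := by push_cast; linarith
    have h1' := Int.cast_lt.1 h1
    have h2' := Int.cast_lt.1 h2
    rw [antipode_coe, coe_eq_coe_iff, coe_eq_coe_iff]
    obtain rfl | rfl | rfl : n = -1 ∨ n = 0 ∨ n = 1 := by omega
    · exact .inr ⟨-1, by push_cast at hn ⊢; linarith⟩
    · exact .inl ⟨0, by push_cast at hn ⊢; linarith⟩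
    · exact .inr ⟨0, by push_cast at hn ⊢; linarith⟩
  · rintro (rfl | rfl)
    · rfl
    · exact dbl_antipode q

theorem dist_coe {s t : ℝ} (h1 : s ≤ t) (h2 : t ≤ s + 1 / 2) :
    dist (s : Circ) (t : Circ) = t - s := by
  rw [dist_comm, dist_eq_norm, ← AddCircle.coe_sub,
    (AddCircle.norm_coe_eq_abs_iff (1 : ℝ) one_ne_zero).2, abs_of_nonneg (by linarith)]
  rw [abs_one, abs_of_nonneg (by linarith)]
  linarith

theorem dist_coe_of_half_le {s t : ℝ} (h1 : s + 1 / 2 ≤ t) (h2 : t ≤ s + 1) :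
    dist (s : Circ) (t : Circ) = 1 - (t - s) := by
  rw [dist_comm, ← coe_add_one s, dist_coe h2 (by linarith)]
  ring

theorem dist_antipode (p q : Circ) : dist (antipode p) (antipode q) = dist p q :=
  dist_add_right _ _ _

theorem exists_lift_pair (p q : Circ) :
    (∃ s t : ℝ, s ≤ t ∧ t ≤ s + 1 / 2 ∧ (s : Circ) = p ∧ (t : Circ) = q) ∨
    ∃ s t : ℝ, s ≤ t ∧ t ≤ s + 1 / 2 ∧ (s : Circ) = q ∧ (t : Circ) = p := by
  obtain ⟨s, -, -, rfl⟩ := exists_lift 0 p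
  obtain ⟨t, ht, ht', rfl⟩ := exists_lift s q
  rcases le_total t (s + 1 / 2) with h | h
  · exact .inl ⟨s, t, ht, h, rfl, rfl⟩
  · exact .inr ⟨t, s + 1, ht'.le, by linarith, rfl, coe_add_one s⟩

theorem exists_lift_chord (c : Chord) :
    ∃ s t : ℝ, s ≤ t ∧ t ≤ s + 1 / 2 ∧ c = s((s : Circ), (t : Circ)) := by
  induction c using Sym2.ind with | _ p q =>
  rcases exists_lift_pair p q with ⟨s, t, h1, h2, rfl, rfl⟩ | ⟨s, t, h1, h2, rfl, rfl⟩
  · exact ⟨s, t, h1, h2, rfl⟩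
  · exact ⟨s, t, h1, h2, Sym2.eq_swap⟩

theorem chordLength_coe {s t : ℝ} (h1 : s ≤ t) (h2 : t ≤ s + 1 / 2) :
    chordLength s((s : Circ), (t : Circ)) = t - s := dist_coe h1 h2

theorem chordLength_coe_of_half_le {s t : ℝ} (h1 : s + 1 / 2 ≤ t) (h2 : t ≤ s + 1) :
    chordLength s((s : Circ), (t : Circ)) = 1 - (t - s) := dist_coe_of_half_le h1 h2

theorem dblChord_coe (s t : ℝ) :
    dblChord s((s : Circ), (t : Circ)) = s(((2 * s : ℝ) : Circ), ((2 * t : ℝ) : Circ)) := by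
  rw [dblChord, Sym2.map_mk, dbl_coe, dbl_coe]

theorem sibling_coe (s t : ℝ) :
    sibling s((s : Circ), (t : Circ)) =
      s(((s + 1 / 2 : ℝ) : Circ), ((t + 1 / 2 : ℝ) : Circ)) := by
  rw [sibling, Sym2.map_mk, antipode_coe, antipode_coe]

theorem dblChord_sibling (c : Chord) : dblChord (sibling c) = dblChord c := by
  induction c using Sym2.ind with | _ p q =>
  simp only [dblChord, sibling, Sym2.map_mk, dbl_antipode]

theorem sibling_sibling (c : Chord) : sibling (sibling c) = c := by
  induction c using Sym2.ind with | _ p q =>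
  simp only [sibling, Sym2.map_mk, antipode_antipode]

theorem chordLength_sibling (c : Chord) : chordLength (sibling c) = chordLength c := by
  induction c using Sym2.ind with | _ p q => exact dist_antipode p q

/-- Doubling acts on lengths of chords as the full tent map of `[0, 1/2]`. -/
theorem chordLength_dblChord (c : Chord) :
    chordLength (dblChord c) = min (2 * chordLength c) (1 - 2 * chordLength c) := by
  obtain ⟨s, t, h1, h2, rfl⟩ := exists_lift_chord c
  rw [dblChord_coe, chordLength_coe h1 h2]
  rcases le_total (t - s) (1 / 4) with h | h
  · rw [chordLength_coe (by linarith) (by linarith), min_eq_left (by linarith)]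
    ring
  · rw [chordLength_coe_of_half_le (by linarith) (by linarith), min_eq_right (by linarith)]
    ring

theorem mem_dblChord {p : Circ} {c : Chord} (h : p ∈ c) : dbl p ∈ dblChord c :=
  Sym2.mem_map.2 ⟨p, h, rfl⟩

theorem mem_sibling {p : Circ} {c : Chord} (h : p ∈ c) : antipode p ∈ sibling c :=
  Sym2.mem_map.2 ⟨p, h, rfl⟩

theorem mem_dblChord_iterate {p : Circ} {c : Chord} (h : p ∈ c) (n : ℕ) :
    dbl^[n] p ∈ dblChord^[n] c := by
  induction n with
  | zero => exact h
  | succ n ih =>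
    rw [Function.iterate_succ_apply', Function.iterate_succ_apply']
    exact mem_dblChord ih

/-! ### Circular order and linked chords in coordinates -/

theorem sbtw_coe {s r t : ℝ} (h1 : s ≤ t) (h2 : t < s + 1) :
    sbtw (s : Circ) r t ↔ ∃ n : ℤ, s < r + n ∧ r + n < t := by
  rw [sbtw_iff_not_btw]
  change ¬ Btw.btw (t : ℝ ⧸ AddSubgroup.zmultiples (1 : ℝ)) r s ↔ _
  rw [QuotientAddGroup.btw_coe_iff, not_le]
  have hs : toIocMod (zero_lt_one' ℝ) t s = s + 1 :=
    (toIocMod_eq_iff _).2 ⟨⟨h2, by linarith⟩, -1, by simp⟩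
  obtain ⟨⟨hr1, hr2⟩, z, hz⟩ := (toIcoMod_eq_iff (zero_lt_one' ℝ) (a := t) (b := r)).1 rfl
  simp only [zsmul_eq_mul, mul_one] at hz
  rw [hs]
  set r' := toIcoMod (zero_lt_one' ℝ) t r
  constructor
  · intro h
    exact ⟨-z - 1, by push_cast; linarith, by push_cast; linarith⟩
  · rintro ⟨n, hn1, hn2⟩
    change s + 1 < r'
    have h3 : ((n + z : ℤ) : ℝ) < (0 : ℤ) := by push_cast; linarith
    have h4 : n + z ≤ -1 := by have := Int.cast_lt.1 h3; omega
    have h5 : ((n + z : ℤ) : ℝ) ≤ (-1 : ℤ) := Int.cast_le.2 h4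
    push_cast at h5
    linarith

theorem sbtw_coe_iff {s r t : ℝ} :
    sbtw (s : Circ) r t ↔ ∃ m n : ℤ, s < r + m ∧ r + m < t + n ∧ t + n < s + 1 := by
  constructor
  · intro h
    obtain ⟨t', h1, h2, ht⟩ := exists_lift s (t : Circ)
    obtain ⟨n, hn⟩ := coe_eq_coe_iff.1 ht
    rw [← ht, sbtw_coe h1 h2] at h
    obtain ⟨m, h3, h4⟩ := h
    exact ⟨m, n, h3, hn ▸ h4, hn ▸ h2⟩
  · rintro ⟨m, n, h1, h2, h3⟩
    rw [← coe_add_int t n, sbtw_coe (by linarith) h3]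
    exact ⟨m, h1, h2⟩

theorem sbtw_antipode {p q r : Circ} :
    sbtw (antipode p) (antipode q) (antipode r) ↔ sbtw p q r := by
  obtain ⟨s, -, -, rfl⟩ := exists_lift 0 p
  obtain ⟨t, -, -, rfl⟩ := exists_lift 0 q
  obtain ⟨u, -, -, rfl⟩ := exists_lift 0 r
  simp only [antipode_coe, sbtw_coe_iff]
  refine exists_congr fun m => exists_congr fun n => ?_
  constructor <;> rintro ⟨h1, h2, h3⟩ <;> exact ⟨by linarith, by linarith, by linarith⟩

theorem isOpen_sbtw : IsOpen {p : Circ × Circ × Circ | sbtw p.1 p.2.1 p.2.2} := by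
  have hmk : IsOpenQuotientMap (fun t : ℝ => (t : Circ)) :=
    QuotientAddGroup.isOpenQuotientMap_mk
  have hq := (hmk.prodMap (hmk.prodMap hmk)).isQuotientMap
  rw [← hq.isOpen_preimage]
  have : (Prod.map (fun t : ℝ => (t : Circ))
      (Prod.map (fun t : ℝ => (t : Circ)) fun t : ℝ => (t : Circ))) ⁻¹'
        {p : Circ × Circ × Circ | sbtw p.1 p.2.1 p.2.2} =
      ⋃ m : ℤ, ⋃ n : ℤ, {x : ℝ × ℝ × ℝ | x.1 < x.2.1 + m} ∩ {x | x.2.1 + m < x.2.2 + n} ∩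
        {x | x.2.2 + n < x.1 + 1} := by
    ext ⟨s, r, t⟩
    simp only [Set.mem_preimage, Prod.map_apply, Set.mem_ofPred_eq, sbtw_coe_iff, Set.mem_iUnion,
      Set.mem_inter_iff, and_assoc]
  rw [this]
  refine isOpen_iUnion fun m => isOpen_iUnion fun n => IsOpen.inter (IsOpen.inter ?_ ?_) ?_ <;>
    exact isOpen_lt (by fun_prop) (by fun_prop)

theorem linked_mk {p q r s : Circ} :
    Linked s(p, q) s(r, s) ↔ (sbtw p r q ∧ sbtw q s p) ∨ (sbtw p s q ∧ sbtw q r p) := by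
  constructor
  · rintro ⟨a, b, c, d, h1, h2, h3, h4⟩
    rcases Sym2.eq_iff.1 h1 with ⟨rfl, rfl⟩ | ⟨rfl, rfl⟩ <;>
    rcases Sym2.eq_iff.1 h2 with ⟨rfl, rfl⟩ | ⟨rfl, rfl⟩ <;> simp [h3, h4]
  · rintro (⟨h1, h2⟩ | ⟨h1, h2⟩)
    · exact ⟨p, q, r, s, rfl, rfl, h1, h2⟩
    · exact ⟨p, q, s, r, rfl, Sym2.eq_swap, h1, h2⟩

theorem Linked.symm {c c' : Chord} (h : Linked c c') : Linked c' c := by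
  obtain ⟨a, b, c, d, rfl, rfl, h1, h2⟩ := h
  exact ⟨c, d, b, a, rfl, Sym2.eq_swap, (h2.cyclic_left.trans_left h1).cyclic_left,
    (h1.cyclic_left.trans_left h2).cyclic_left⟩

theorem isOpen_linked :
    IsOpen {p : (Circ × Circ) × (Circ × Circ) | Linked s(p.1.1, p.1.2) s(p.2.1, p.2.2)} := by
  simp only [linked_mk, Set.ofPred_or, Set.ofPred_and]
  have key (f : (Circ × Circ) × (Circ × Circ) → Circ × Circ × Circ) (hf : Continuous f) :
      IsOpen {p | sbtw (f p).1 (f p).2.1 (f p).2.2} := isOpen_sbtw.preimage hf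
  exact ((key (fun p => (p.1.1, p.2.1, p.1.2)) (by fun_prop)).inter
    (key (fun p => (p.1.2, p.2.2, p.1.1)) (by fun_prop))).union
    ((key (fun p => (p.1.1, p.2.2, p.1.2)) (by fun_prop)).inter
    (key (fun p => (p.1.2, p.2.1, p.1.1)) (by fun_prop)))

/-- For chords with ends in an arc shorter than the circle, linking is strict interleaving of the
coordinates of the ends. -/
theorem linked_coe_iff {u v s t p q : ℝ} (huv : v < u + 1) (hs : u ≤ s) (hst : s ≤ t) (ht : t ≤ v)
    (hp : p ∈ Set.Icc u v) (hq : q ∈ Set.Icc u v) :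
    Linked s((s : Circ), (t : Circ)) s((p : Circ), (q : Circ)) ↔
      (s < p ∧ p < t ∧ (q < s ∨ t < q)) ∨ (s < q ∧ q < t ∧ (p < s ∨ t < p)) := by
  obtain ⟨hp1, hp2⟩ := hp
  obtain ⟨hq1, hq2⟩ := hq
  rcases hst.eq_or_lt with rfl | hst
  · simp only [linked_mk, sbtw_irrefl_left_right, false_and, or_self, false_iff]
    rintro (⟨h1, h2, -⟩ | ⟨h1, h2, -⟩) <;> linarith
  have inner (r : ℝ) (h1 : u ≤ r) (h2 : r ≤ v) : sbtw (s : Circ) r t ↔ s < r ∧ r < t := by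
    rw [sbtw_coe hst.le (by linarith)]
    refine ⟨?_, fun h => ⟨0, by simpa using h⟩⟩
    rintro ⟨n, hn1, hn2⟩
    have h3 : ((-1 : ℤ) : ℝ) < n := by push_cast; linarith
    have h4 : (n : ℝ) < (1 : ℤ) := by push_cast; linarith
    have h3' := Int.cast_lt.1 h3
    have h4' := Int.cast_lt.1 h4
    obtain rfl : n = 0 := by omega
    simpa using And.intro hn1 hn2
  have outer (r : ℝ) (h1 : u ≤ r) (h2 : r ≤ v) : sbtw (t : Circ) r s ↔ r < s ∨ t < r := by
    rw [← coe_add_one s, sbtw_coe (by linarith) (by linarith)]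
    constructor
    · rintro ⟨n, hn1, hn2⟩
      by_contra! h
      have h3 : ((0 : ℤ) : ℝ) < n := by push_cast; linarith
      have h4 : (n : ℝ) < (1 : ℤ) := by push_cast; linarith
      have h3' := Int.cast_lt.1 h3
      have h4' := Int.cast_lt.1 h4
      omega
    · rintro (h | h)
      · exact ⟨1, by push_cast; linarith, by push_cast; linarith⟩
      · exact ⟨0, by push_cast; linarith, by push_cast; linarith⟩
  rw [linked_mk, inner p hp1 hp2, inner q hq1 hq2, outer p hp1 hp2, outer q hq1 hq2]
  tauto

/-! ### Chords with both ends in an arc -/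

/-- Both ends of the chord `c` lie in the closed arc that is the image of the interval `[u, v]`. -/
def InArc (u v : ℝ) (c : Chord) : Prop := ∀ p ∈ c, ∃ t ∈ Set.Icc u v, (t : Circ) = p

theorem inArc_coe {u v s t : ℝ} (hs : s ∈ Set.Icc u v) (ht : t ∈ Set.Icc u v) :
    InArc u v s((s : Circ), (t : Circ)) := by
  intro p hp
  rcases Sym2.mem_iff.1 hp with rfl | rfl
  exacts [⟨s, hs, rfl⟩, ⟨t, ht, rfl⟩]

theorem InArc.exists_coe {u v : ℝ} {c : Chord} (h : InArc u v c) :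
    ∃ s t : ℝ, u ≤ s ∧ s ≤ t ∧ t ≤ v ∧ c = s((s : Circ), (t : Circ)) := by
  induction c using Sym2.ind with | _ p q =>
  obtain ⟨s, ⟨hs1, hs2⟩, rfl⟩ := h p (Sym2.mem_mk_left _ _)
  obtain ⟨t, ⟨ht1, ht2⟩, rfl⟩ := h q (Sym2.mem_mk_right _ _)
  rcases le_total s t with h | h
  · exact ⟨s, t, hs1, h, ht2, rfl⟩
  · exact ⟨t, s, ht1, h, hs2, Sym2.eq_swap⟩

theorem InArc.mono {u v u' v' : ℝ} {c : Chord} (h : InArc u v c) (hu : u' ≤ u) (hv : v ≤ v') :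
    InArc u' v' c := fun p hp =>
  let ⟨t, ht, hp⟩ := h p hp
  ⟨t, ⟨hu.trans ht.1, ht.2.trans hv⟩, hp⟩

theorem InArc.sub_one {u v : ℝ} {c : Chord} (h : InArc u v c) : InArc (u - 1) (v - 1) c :=
  fun p hp =>
  let ⟨t, ht, hp⟩ := h p hp
  ⟨t - 1, ⟨by linarith [ht.1], by linarith [ht.2]⟩,
    (coe_eq_coe_iff.2 ⟨-1, by push_cast; ring⟩ : ((t - 1 : ℝ) : Circ) = t).trans hp⟩

theorem InArc.sibling {u v : ℝ} {c : Chord} (h : InArc u v c) :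
    InArc (u + 1 / 2) (v + 1 / 2) (sibling c) := by
  obtain ⟨s, t, h1, h2, h3, rfl⟩ := h.exists_coe
  rw [sibling_coe]
  exact inArc_coe ⟨by linarith, by linarith⟩ ⟨by linarith, by linarith⟩

theorem InArc.not_linked {u v : ℝ} {c c' : Chord} (h : InArc u v c) (h' : InArc v (u + 1) c') :
    ¬ Linked c c' := by
  obtain ⟨s, t, h1, h2, h3, rfl⟩ := h.exists_coe
  obtain ⟨p, q, h4, h5, h6, rfl⟩ := h'.exists_coe
  rw [linked_mk]
  have key (r : ℝ) (hr : v ≤ r) (hr' : r ≤ u + 1) : ¬ sbtw (s : Circ) r t := by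
    intro h
    rcases (show t ≤ s + 1 by linarith).eq_or_lt with ht | ht
    · rw [ht, coe_add_one] at h
      exact sbtw_irrefl_left_right h
    · obtain ⟨n, hn1, hn2⟩ := (sbtw_coe h2 ht).1 h
      have h7 : ((-1 : ℤ) : ℝ) < n := by push_cast; linarith
      have h8 : (n : ℝ) < (0 : ℤ) := by push_cast; linarith
      have h7' := Int.cast_lt.1 h7
      have h8' := Int.cast_lt.1 h8
      omega
  rintro (⟨h, -⟩ | ⟨h, -⟩)
  · exact key p h4 (by linarith) h
  · exact key q (by linarith) h6 h

/-- A chord that does not cross `s(u, v)` lies on one of its two sides. -/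
theorem inArc_or_of_not_linked {u v : ℝ} {c : Chord} (h1 : u ≤ v) (h2 : v < u + 1)
    (h : ¬ Linked s((u : Circ), (v : Circ)) c) : InArc u v c ∨ InArc v (u + 1) c := by
  induction c using Sym2.ind with | _ p q =>
  obtain ⟨s, hs1, hs2, rfl⟩ := exists_lift u p
  obtain ⟨t, ht1, ht2, rfl⟩ := exists_lift u q
  have hv : max v (max s t) < u + 1 := max_lt h2 (max_lt hs2 ht2)
  have m1 := le_max_left v (max s t)
  have m2 := le_max_right v (max s t)
  have m3 := (le_max_left s t).trans m2
  have m4 := (le_max_right s t).trans m2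
  rw [linked_coe_iff hv le_rfl h1 m1 ⟨hs1, m3⟩ ⟨ht1, m4⟩] at h
  have wrap (r w : ℝ) (hr : r = u) (hw : v ≤ w) (hw' : w < u + 1) :
      InArc v (u + 1) s((r : Circ), (w : Circ)) := by
    rw [hr, ← coe_add_one u]
    exact inArc_coe ⟨by linarith, by linarith⟩ ⟨by linarith, by linarith⟩
  rcases le_or_gt s v with hs | hs <;> rcases le_or_gt t v with ht | ht
  · exact .inl (inArc_coe ⟨hs1, hs⟩ ⟨ht1, ht⟩)
  · right
    rcases hs1.eq_or_lt with hsu | hsu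
    · exact wrap s t hsu.symm ht.le ht2
    · rcases hs.eq_or_lt with hsv | hsv
      · exact inArc_coe ⟨by linarith, by linarith⟩ ⟨by linarith, by linarith⟩
      · exact absurd (.inl ⟨hsu, hsv, .inr ht⟩) h
  · right
    rcases ht1.eq_or_lt with htu | htu
    · rw [Sym2.eq_swap]
      exact wrap t s htu.symm hs.le hs2
    · rcases ht.eq_or_lt with htv | htv
      · exact inArc_coe ⟨by linarith, by linarith⟩ ⟨by linarith, by linarith⟩
      · exact absurd (.inr ⟨htu, htv, .inr hs⟩) h
  · exact .inr (inArc_coe ⟨by linarith, by linarith⟩ ⟨by linarith, by linarith⟩)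

/-- Doubling is injective and preserves the order on an arc shorter than a half-circle, so it keeps
chords with ends in such an arc linked. -/
theorem linked_dblChord {u v : ℝ} {c c' : Chord} (huv : v < u + 1 / 2) (h : InArc u v c)
    (h' : InArc u v c') (hl : Linked c c') : Linked (dblChord c) (dblChord c') := by
  obtain ⟨s, t, h1, h2, h3, rfl⟩ := h.exists_coe
  obtain ⟨p, q, h4, h5, h6, rfl⟩ := h'.exists_coe
  rw [linked_coe_iff (by linarith) h1 h2 h3 ⟨h4, h5.trans h6⟩ ⟨h4.trans h5, h6⟩] at hl
  rw [dblChord_coe, dblChord_coe, linked_coe_iff (u := 2 * u) (v := 2 * v) (by linarith)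
    (by linarith) (by linarith) (by linarith) ⟨by linarith, by linarith⟩
    ⟨by linarith, by linarith⟩]
  simpa only [mul_lt_mul_iff_right₀ (zero_lt_two' ℝ)] using hl

theorem mem_closedArc_coe {u v : ℝ} (h1 : u ≤ v) (h2 : v < u + 1 / 2) {p : Circ} :
    p ∈ closedArc s((u : Circ), (v : Circ)) ↔ ∃ t ∈ Set.Icc u v, (t : Circ) = p := by
  have key : p ∈ closedArc s((u : Circ), (v : Circ)) ↔
      dist (u : Circ) p + dist p v = dist (u : Circ) v := by
    constructor
    · rintro ⟨a, b, h, hab⟩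
      rcases Sym2.eq_iff.1 h with ⟨rfl, rfl⟩ | ⟨rfl, rfl⟩
      · exact hab
      · rw [dist_comm (u : Circ) (v : Circ), ← hab, dist_comm (u : Circ), dist_comm (v : Circ),
          add_comm]
    · exact fun h => ⟨_, _, rfl, h⟩
  rw [key, dist_coe h1 h2.le]
  constructor
  · obtain ⟨t, ht1, ht2, rfl⟩ := exists_lift u p
    intro h
    refine ⟨t, ⟨ht1, ?_⟩, rfl⟩
    by_contra! hv
    rw [dist_comm (t : Circ)] at h
    rcases le_total t (u + 1 / 2) with ht | ht
    · rw [dist_coe ht1 ht, dist_coe hv.le (by linarith)] at h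
      linarith
    · rw [dist_coe_of_half_le ht ht2.le] at h
      rcases le_total t (v + 1 / 2) with ht' | ht'
      · rw [dist_coe hv.le ht'] at h
        linarith
      · rw [dist_coe_of_half_le ht' (by linarith)] at h
        linarith
  · rintro ⟨t, ⟨ht1, ht2⟩, rfl⟩
    rw [dist_coe ht1 (by linarith), dist_coe ht2 (by linarith)]
    ring

theorem behind_coe_iff {u v : ℝ} (h1 : u ≤ v) (h2 : v < u + 1 / 2) {c : Chord} :
    Behind c s((u : Circ), (v : Circ)) ↔ InArc u v c :=
  forall₂_congr fun _ _ => mem_closedArc_coe h1 h2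

theorem exists_lift_chord_of_lt {c : Chord} (h : chordLength c < 1 / 2) :
    ∃ u v : ℝ, u ≤ v ∧ v < u + 1 / 2 ∧ c = s((u : Circ), (v : Circ)) := by
  obtain ⟨u, v, h1, h2, rfl⟩ := exists_lift_chord c
  rw [chordLength_coe h1 h2] at h
  exact ⟨u, v, h1, by linarith, rfl⟩

theorem Behind.closedArc_subset {c c' : Chord} (hc : chordLength c < 1 / 2) (h : Behind c' c) :
    closedArc c' ⊆ closedArc c := by
  obtain ⟨u, v, h1, h2, rfl⟩ := exists_lift_chord_of_lt hc
  rw [behind_coe_iff h1 h2] at h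
  obtain ⟨s, t, h3, h4, h5, rfl⟩ := h.exists_coe
  intro p hp
  rw [mem_closedArc_coe h4 (by linarith)] at hp
  obtain ⟨r, ⟨h6, h7⟩, hr⟩ := hp
  exact (mem_closedArc_coe h1 h2).2 ⟨r, ⟨h3.trans h6, h7.trans h5⟩, hr⟩

/-! ### Building quadratic laminations from invariant families of chords -/

/-- The limits of the chords of a family `G`, taken in the space of ordered pairs of points. -/
def chordClosure (G : Set Chord) : Set Chord :=
  {c | ∃ p ∈ closure {p : Circ × Circ | s(p.1, p.2) ∈ G}, c = s(p.1, p.2)}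

theorem mk_mem_chordClosure {G : Set Chord} {p : Circ × Circ} :
    s(p.1, p.2) ∈ chordClosure G ↔ p ∈ closure {p : Circ × Circ | s(p.1, p.2) ∈ G} := by
  refine ⟨?_, fun h => ⟨p, h, rfl⟩⟩
  rintro ⟨q, hq, h⟩
  rcases Sym2.eq_iff.1 h with ⟨h1, h2⟩ | ⟨h1, h2⟩
  · rwa [Prod.ext h1 h2]
  · have hp : p = q.swap := Prod.ext h1 h2
    rw [hp]
    refine map_mem_closure continuous_swap hq fun r hr => ?_
    change s(r.2, r.1) ∈ G
    rwa [Sym2.eq_swap]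

theorem subset_chordClosure (G : Set Chord) : G ⊆ chordClosure G := by
  intro c hc
  induction c using Sym2.ind with | _ p q =>
  exact ⟨(p, q), subset_closure hc, rfl⟩

theorem continuous_dbl : Continuous dbl := continuous_id.add continuous_id

theorem continuous_antipode : Continuous antipode := continuous_id.add continuous_const

theorem isQuadraticLamination_chordClosure {G : Set Chord}
    (unlinked : ∀ c ∈ G, ∀ c' ∈ G, ¬ Linked c c') (points : ∀ x : Circ, s(x, x) ∈ G)
    (forward : ∀ c ∈ G, dblChord c ∈ G) (backward : ∀ c ∈ G, ∃ c₁ ∈ G, dblChord c₁ = c)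
    (sibling_mem : ∀ c ∈ G, sibling c ∈ G) : IsQuadraticLamination (chordClosure G) where
  unlinked := by
    rintro _ ⟨p, hp, rfl⟩ _ ⟨q, hq, rfl⟩ h
    have hsub : {p : Circ × Circ | s(p.1, p.2) ∈ G} ×ˢ {p : Circ × Circ | s(p.1, p.2) ∈ G} ⊆
        {p : (Circ × Circ) × (Circ × Circ) | Linked s(p.1.1, p.1.2) s(p.2.1, p.2.2)}ᶜ :=
      fun r hr => unlinked _ hr.1 _ hr.2
    have hcl := closure_minimal hsub isOpen_linked.isClosed_compl
    rw [closure_prod_eq] at hcl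
    exact hcl (Set.mk_mem_prod hp hq) h
  points x := subset_chordClosure G (points x)
  closed := by
    simp only [mk_mem_chordClosure]
    exact isClosed_closure
  forward := by
    rintro _ ⟨p, hp, rfl⟩
    exact ⟨Prod.map dbl dbl p, map_mem_closure (continuous_dbl.prodMap continuous_dbl) hp
      fun r hr => forward _ hr, rfl⟩
  backward := by
    rintro _ ⟨p, hp, rfl⟩
    have hcont := continuous_dbl.prodMap continuous_dbl
    have hcl := ((isClosed_closure (s := {p : Circ × Circ | s(p.1, p.2) ∈ G})).isCompact.image
      hcont).isClosed
    have hsub : {p : Circ × Circ | s(p.1, p.2) ∈ G} ⊆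
        Prod.map dbl dbl '' closure {p : Circ × Circ | s(p.1, p.2) ∈ G} := by
      intro r hr
      obtain ⟨c, hc, h⟩ := backward _ hr
      induction c using Sym2.ind with | _ a b =>
      rcases Sym2.eq_iff.1 h with ⟨h1, h2⟩ | ⟨h1, h2⟩
      · exact ⟨(a, b), subset_closure hc, Prod.ext h1 h2⟩
      · rw [Sym2.eq_swap] at hc
        exact ⟨(b, a), subset_closure hc, Prod.ext h2 h1⟩
    obtain ⟨q, hq, rfl⟩ := closure_minimal hsub hcl hp
    exact ⟨s(q.1, q.2), ⟨q, hq, rfl⟩, rfl⟩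
  sibling_mem := by
    rintro _ ⟨p, hp, rfl⟩
    exact ⟨Prod.map antipode antipode p,
      map_mem_closure (continuous_antipode.prodMap continuous_antipode) hp
        fun r hr => sibling_mem _ hr, rfl⟩

/-- The chords `s(x, y)` and its sibling cut the circle into four closed arcs; a chord is tame if
both its ends lie in one of them. -/
def Tame (x y : ℝ) (c : Chord) : Prop :=
  InArc x y c ∨ InArc y (x + 1 / 2) c ∨ InArc (x + 1 / 2) (y + 1 / 2) c ∨
    InArc (y + 1 / 2) (x + 1) c

theorem tame_diag (x y : ℝ) (p : Circ) : Tame x y s(p, p) := by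
  obtain ⟨t, ht1, ht2, rfl⟩ := exists_lift x p
  rcases le_total t y with h | h
  · exact .inl (inArc_coe ⟨ht1, h⟩ ⟨ht1, h⟩)
  rcases le_total t (x + 1 / 2) with h' | h'
  · exact .inr (.inl (inArc_coe ⟨h, h'⟩ ⟨h, h'⟩))
  rcases le_total t (y + 1 / 2) with h'' | h''
  · exact .inr (.inr (.inl (inArc_coe ⟨h', h''⟩ ⟨h', h''⟩)))
  · exact .inr (.inr (.inr (inArc_coe ⟨h'', ht2.le⟩ ⟨h'', ht2.le⟩)))

theorem Tame.sibling {x y : ℝ} {c : Chord} (h : Tame x y c) : Tame x y (sibling c) := by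
  rcases h with h | h | h | h
  · exact .inr (.inr (.inl h.sibling))
  · exact .inr (.inr (.inr (h.sibling.mono le_rfl (by linarith))))
  · exact .inl (h.sibling.sub_one.mono (by linarith) (by linarith))
  · exact .inr (.inl (h.sibling.sub_one.mono (by linarith) (by linarith)))

theorem Tame.chordLength_le {x y : ℝ} {c : Chord} (h1 : x + 1 / 4 ≤ y) (h2 : y < x + 1 / 2)
    (h : Tame x y c) : chordLength c ≤ y - x := by
  have key {u v : ℝ} (h : InArc u v c) (h' : v - u ≤ y - x) : chordLength c ≤ y - x := by
    obtain ⟨s, t, h3, h4, h5, rfl⟩ := h.exists_coe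
    rw [chordLength_coe h4 (by linarith)]
    linarith
  rcases h with h | h | h | h <;> exact key h (by linarith)

theorem Tame.linked_dblChord {x y : ℝ} {c c' : Chord} (h1 : x < y) (h2 : y < x + 1 / 2)
    (h : Tame x y c) (h' : Tame x y c') (hl : Linked c c') :
    Linked (dblChord c) (dblChord c') := by
  have key {u v u' v' : ℝ} {c c' : Chord} (h : InArc u v c) (h' : InArc u' v' c')
      (hu : v ≤ u') (hv : v' ≤ u + 1) : ¬ Linked c c' := h.not_linked (h'.mono hu hv)
  rcases h with h | h | h | h <;> rcases h' with h' | h' | h' | h' <;>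
  first
  | exact QuadLam.linked_dblChord (by linarith) h h' hl
  | exact absurd hl (key h h' (by linarith) (by linarith))
  | exact absurd hl.symm (key h' h (by linarith) (by linarith))

/-- The tame chords with tame forward orbit that eventually land in the orbit of `m`, together with
the points of the circle. -/
def tamePreorbit (x y : ℝ) (m : Chord) : Set Chord :=
  {c | (∀ n, Tame x y (dblChord^[n] c)) ∧
    (c.IsDiag ∨ ∃ N k, dblChord^[N] c = dblChord^[k] m)}

theorem dblChord_iterate_diag (n : ℕ) (p : Circ) : ∃ q, dblChord^[n] s(p, p) = s(q, q) := by
  induction n with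
  | zero => exact ⟨p, rfl⟩
  | succ n ih =>
    obtain ⟨q, hq⟩ := ih
    exact ⟨dbl q, by rw [Function.iterate_succ_apply', hq]; rfl⟩

theorem not_linked_diag_left (p : Circ) (c : Chord) : ¬ Linked s(p, p) c := by
  induction c using Sym2.ind with | _ a b =>
  simp [linked_mk, sbtw_irrefl_left_right]

theorem not_linked_tamePreorbit {x y : ℝ} {m : Chord} (h1 : x < y) (h2 : y < x + 1 / 2)
    (hm : ∀ n k, ¬ Linked (dblChord^[n] m) (dblChord^[k] m)) {c c' : Chord}
    (hc : c ∈ tamePreorbit x y m) (hc' : c' ∈ tamePreorbit x y m) : ¬ Linked c c' := by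
  intro hl
  have key (n : ℕ) : Linked (dblChord^[n] c) (dblChord^[n] c') := by
    induction n with
    | zero => exact hl
    | succ n ih =>
      rw [Function.iterate_succ_apply', Function.iterate_succ_apply']
      exact (hc.1 n).linked_dblChord h1 h2 (hc'.1 n) ih
  rcases hc.2 with h | ⟨N, k, h⟩
  · induction c using Sym2.ind with | _ a b =>
    obtain rfl : a = b := h
    exact not_linked_diag_left _ _ hl
  rcases hc'.2 with h' | ⟨N', k', h'⟩
  · induction c' using Sym2.ind with | _ a b =>
    obtain rfl : a = b := h'
    exact not_linked_diag_left _ _ hl.symm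
  have := key (N' + N)
  rw [Function.iterate_add_apply, h, add_comm, Function.iterate_add_apply, h',
    ← Function.iterate_add_apply, ← Function.iterate_add_apply] at this
  exact hm _ _ this

/-- A criterion for minors: the chord with ends `2x`, `2y` is a minor as soon as its forward orbit
consists of pairwise unlinked chords that do not leave the four arcs cut out by its preimages
`s(x, y)` and `s(x + 1/2, y + 1/2)`. -/
theorem mem_QML_of_tame {x y : ℝ} (h1 : x + 1 / 4 ≤ y) (h2 : y < x + 1 / 2)
    (ht : ∀ n, Tame x y (dblChord^[n] s(((2 * x : ℝ) : Circ), ((2 * y : ℝ) : Circ))))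
    (hm : ∀ n k, ¬ Linked (dblChord^[n] s(((2 * x : ℝ) : Circ), ((2 * y : ℝ) : Circ)))
      (dblChord^[k] s(((2 * x : ℝ) : Circ), ((2 * y : ℝ) : Circ)))) :
    s(((2 * x : ℝ) : Circ), ((2 * y : ℝ) : Circ)) ∈ QML := by
  set m : Chord := s(((2 * x : ℝ) : Circ), ((2 * y : ℝ) : Circ)) with hmdef
  have hself : m ∈ tamePreorbit x y m := ⟨ht, .inr ⟨0, 0, rfl⟩⟩
  -- A chord of the family is pulled back through the arc that covers its side of `m`.
  have backward : ∀ c ∈ tamePreorbit x y m, ∃ c₁ ∈ tamePreorbit x y m, dblChord c₁ = c := by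
    intro c hc
    have lift {u v : ℝ} (h : InArc (2 * u) (2 * v) c) : ∃ c₁, InArc u v c₁ ∧ dblChord c₁ = c ∧
        (c.IsDiag → c₁.IsDiag) := by
      obtain ⟨s, t, h3, h4, h5, rfl⟩ := h.exists_coe
      by_cases hd : (s : Circ) = t
      · refine ⟨s(((s / 2 : ℝ) : Circ), ((s / 2 : ℝ) : Circ)), inArc_coe ⟨by linarith, by linarith⟩
          ⟨by linarith, by linarith⟩, ?_, fun _ => rfl⟩
        rw [dblChord_coe, ← hd]
        ring_nf
      · refine ⟨s(((s / 2 : ℝ) : Circ), ((t / 2 : ℝ) : Circ)), inArc_coe ⟨by linarith, by linarith⟩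
          ⟨by linarith, by linarith⟩, ?_, fun h => absurd h hd⟩
        rw [dblChord_coe]
        ring_nf
    have mem {c₁ : Chord} (ht₁ : Tame x y c₁) (h : dblChord c₁ = c)
        (hd : c.IsDiag → c₁.IsDiag) : c₁ ∈ tamePreorbit x y m := by
      refine ⟨fun n => ?_, hc.2.imp hd ?_⟩
      · cases n with
        | zero => exact ht₁
        | succ n =>
          rw [Function.iterate_succ_apply, h]
          exact hc.1 n
      · rintro ⟨N, k, hN⟩
        exact ⟨N + 1, k, by rw [Function.iterate_succ_apply, h, hN]⟩
    rcases inArc_or_of_not_linked (by linarith) (by linarith)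
      (not_linked_tamePreorbit (by linarith) h2 hm hself hc) with h | h
    · obtain ⟨c₁, h3, h4, h5⟩ := lift h
      exact ⟨c₁, mem (.inl h3) h4 h5, h4⟩
    · obtain ⟨c₁, h3, h4, h5⟩ := lift (u := y) (v := x + 1 / 2) (h.mono le_rfl (by linarith))
      exact ⟨c₁, mem (.inr (.inl h3)) h4 h5, h4⟩
  refine ⟨chordClosure (tamePreorbit x y m), isQuadraticLamination_chordClosure
    (fun c hc c' hc' => not_linked_tamePreorbit (by linarith) h2 hm hc hc') (fun p => ?_) ?_
    backward ?_, s((x : Circ), (y : Circ)), ⟨subset_chordClosure _ ?_, ?_⟩, dblChord_coe x y⟩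
  · refine ⟨fun n => ?_, .inl rfl⟩
    obtain ⟨q, hq⟩ := dblChord_iterate_diag n p
    rw [hq]
    exact tame_diag x y q
  · rintro c ⟨hc1, hc2⟩
    refine ⟨fun n => hc1 (n + 1), hc2.imp ?_ ?_⟩
    · exact fun h => h.map
    · rintro ⟨N, k, hN⟩
      exact ⟨N, k + 1, by
        rw [← Function.iterate_succ_apply, Function.iterate_succ_apply', hN,
          ← Function.iterate_succ_apply' dblChord]⟩
  · rintro c ⟨hc1, hc2⟩
    have hit (n : ℕ) : dblChord^[n + 1] (sibling c) = dblChord^[n + 1] c := by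
      rw [Function.iterate_succ_apply, dblChord_sibling, ← Function.iterate_succ_apply]
    refine ⟨fun n => ?_, hc2.imp (fun h => h.map) ?_⟩
    · cases n with
      | zero => exact (hc1 0).sibling
      | succ n =>
        rw [hit]
        exact hc1 _
    · rintro ⟨N, k, hN⟩
      exact ⟨N + 1, k + 1, by
        rw [hit, Function.iterate_succ_apply', hN, ← Function.iterate_succ_apply' dblChord]⟩
  · have hdbl : dblChord s((x : Circ), (y : Circ)) = m := dblChord_coe x y
    refine ⟨fun n => ?_, .inr ⟨1, 0, hdbl⟩⟩
    cases n with
    | zero => exact .inl (inArc_coe ⟨le_rfl, by linarith⟩ ⟨by linarith, le_rfl⟩)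
    | succ n =>
      rw [Function.iterate_succ_apply, hdbl]
      exact ht n
  · rintro _ ⟨p, hp, rfl⟩
    rw [chordLength_coe (s := x) (t := y) (by linarith) h2.le]
    refine closure_minimal (t := {p : Circ × Circ | dist p.1 p.2 ≤ y - x}) (fun q hq => ?_)
      (isClosed_le continuous_dist continuous_const) hp
    exact (hq.1 0).chordLength_le h1 h2

/-! ### Leaves and majors of sibling invariant families -/

/-- A family of pairwise unlinked chords that is closed under `σ₂` and under taking siblings: the
part of the definition of a quadratic lamination that concerns forward orbits of leaves. -/
structure IsSiblingInvariant (L : Set Chord) : Prop where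
  unlinked : ∀ c ∈ L, ∀ c' ∈ L, ¬ Linked c c'
  forward : ∀ c ∈ L, dblChord c ∈ L
  sibling_mem : ∀ c ∈ L, sibling c ∈ L

theorem IsQuadraticLamination.isSiblingInvariant {L : Set Chord} (h : IsQuadraticLamination L) :
    IsSiblingInvariant L := ⟨h.unlinked, h.forward, h.sibling_mem⟩

theorem behind_of_mem_openArc {c m : Chord} {p : Circ} (hm : chordLength m < 1 / 2)
    (h : ¬ Linked m c) (hpc : p ∈ c) (hp : p ∈ openArc m) : Behind c m := by
  obtain ⟨u, v, h1, h2, rfl⟩ := exists_lift_chord_of_lt hm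
  rw [behind_coe_iff h1 h2]
  refine (inArc_or_of_not_linked h1 (by linarith) h).resolve_right fun h' => hp.2 ?_
  obtain ⟨t, ⟨ht1, ht2⟩, rfl⟩ := (mem_closedArc_coe h1 h2).1 hp.1
  obtain ⟨s, ⟨hs1, hs2⟩, hs⟩ := h' _ hpc
  obtain ⟨n, hn⟩ := coe_eq_coe_iff.1 hs
  have h3 : ((-1 : ℤ) : ℝ) < n := by push_cast; linarith
  have h4 : (n : ℝ) < (2 : ℤ) := by push_cast; linarith
  have h3' := Int.cast_lt.1 h3
  have h4' := Int.cast_lt.1 h4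
  obtain rfl | rfl : n = 0 ∨ n = 1 := by omega
  · push_cast at hn
    rw [show t = v by linarith]
    exact Sym2.mem_mk_right _ _
  · push_cast at hn
    rw [show t = u by linarith]
    exact Sym2.mem_mk_left _ _

theorem eq_of_behind {c m : Chord} (hm : chordLength m < 1 / 2) (h : Behind c m)
    (hl : chordLength m ≤ chordLength c) : c = m := by
  obtain ⟨u, v, h1, h2, rfl⟩ := exists_lift_chord_of_lt hm
  rw [behind_coe_iff h1 h2] at h
  obtain ⟨s, t, h3, h4, h5, rfl⟩ := h.exists_coe
  rw [chordLength_coe h1 h2.le, chordLength_coe h4 (by linarith)] at hl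
  rw [show s = u by linarith, show t = v by linarith]

namespace IsSiblingInvariant

variable {L : Set Chord} {M : Chord}

theorem iterate_mem (hL : IsSiblingInvariant L) {c : Chord} (hc : c ∈ L) (n : ℕ) :
    dblChord^[n] c ∈ L := by
  induction n with
  | zero => exact hc
  | succ n ih =>
    rw [Function.iterate_succ_apply']
    exact hL.forward _ ih

theorem major_lt (hnd : ¬ (dblChord M).IsDiag) : chordLength M < 1 / 2 := by
  obtain ⟨s, t, h1, h2, rfl⟩ := exists_lift_chord M
  rw [chordLength_coe h1 h2]
  rcases h2.lt_or_eq with h | h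
  · linarith
  · refine absurd ?_ hnd
    rw [dblChord_coe, h, show 2 * (s + 1 / 2) = 2 * s + 1 by ring, coe_add_one]
    rfl

theorem le_major (hL : IsSiblingInvariant L) (hM : IsMajor L M) (hnd : ¬ (dblChord M).IsDiag) :
    1 / 3 ≤ chordLength M := by
  have hlen := hM.2 _ (hL.forward _ hM.1)
  rw [chordLength_dblChord, min_le_iff] at hlen
  have hpos : 0 < chordLength M := by
    obtain ⟨s, t, h1, h2, rfl⟩ := exists_lift_chord M
    rw [chordLength_coe h1 h2]
    rcases h1.lt_or_eq with h | rfl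
    · linarith
    · exact absurd (by rw [dblChord_coe]; rfl) hnd
  rcases hlen with h | h <;> linarith

theorem chordLength_minor (hL : IsSiblingInvariant L) (hM : IsMajor L M)
    (hnd : ¬ (dblChord M).IsDiag) : chordLength (dblChord M) = 1 - 2 * chordLength M := by
  have := hL.le_major hM hnd
  rw [chordLength_dblChord, min_eq_right (by linarith)]

theorem chordLength_minor_lt (hL : IsSiblingInvariant L) (hM : IsMajor L M)
    (hnd : ¬ (dblChord M).IsDiag) : chordLength (dblChord M) < 1 / 2 := by
  have := hL.le_major hM hnd
  rw [hL.chordLength_minor hM hnd]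
  linarith

/-- The images of a major are never shorter than the minor: among lengths between that of the minor
and that of the major the tent map does not go below the former. -/
theorem chordLength_minor_le_iterate (hL : IsSiblingInvariant L) (hM : IsMajor L M)
    (hnd : ¬ (dblChord M).IsDiag) (n : ℕ) :
    1 - 2 * chordLength M ≤ chordLength (dblChord^[n] M) := by
  have h3 := hL.le_major hM hnd
  induction n with
  | zero =>
    change _ ≤ chordLength M
    linarith
  | succ n ih =>
    have := hM.2 _ (hL.iterate_mem hM.1 n)
    rw [Function.iterate_succ_apply', chordLength_dblChord, le_min_iff]
    constructor <;> linarith [major_lt hnd]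

/-- Every leaf is tame with respect to a major: the only leaves that join the two short arcs of the
central strip are the major and its sibling, by maximality of their length. -/
theorem tame (hL : IsSiblingInvariant L) {x y : ℝ} (h1 : x ≤ y) (h2 : y < x + 1 / 2)
    (hM : IsMajor L s((x : Circ), (y : Circ))) {c : Chord} (hc : c ∈ L) : Tame x y c := by
  rcases inArc_or_of_not_linked h1 (by linarith) (hL.unlinked _ hM.1 _ hc) with h | h
  · exact .inl h
  have hs := hL.sibling_mem _ hM.1
  rw [sibling_coe] at hs
  rcases inArc_or_of_not_linked (by linarith) (by linarith) (hL.unlinked _ hs _ hc) with h' | h'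
  · exact .inr (.inr (.inl h'))
  have side {p : Circ} (hp : p ∈ c) : (∃ t ∈ Set.Icc y (x + 1 / 2), (t : Circ) = p) ∨
      ∃ t ∈ Set.Icc (y + 1 / 2) (x + 1), (t : Circ) = p := by
    obtain ⟨s, ⟨hs1, hs2⟩, rfl⟩ := h p hp
    obtain ⟨t, ⟨ht1, ht2⟩, ht⟩ := h' _ hp
    obtain ⟨n, hn⟩ := coe_eq_coe_iff.1 ht
    have h3 : ((-1 : ℤ) : ℝ) < n := by push_cast; linarith
    have h4 : (n : ℝ) < (2 : ℤ) := by push_cast; linarith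
    have h3' := Int.cast_lt.1 h3
    have h4' := Int.cast_lt.1 h4
    obtain rfl | rfl : n = 0 ∨ n = 1 := by omega
    · push_cast at hn
      exact .inr ⟨s, ⟨by linarith, hs2⟩, rfl⟩
    · push_cast at hn
      exact .inl ⟨s, ⟨hs1, by linarith⟩, rfl⟩
  have across {s t : ℝ} (hs : s ∈ Set.Icc y (x + 1 / 2)) (ht : t ∈ Set.Icc (y + 1 / 2) (x + 1))
      (hc : s((s : Circ), (t : Circ)) ∈ L) : Tame x y s((s : Circ), (t : Circ)) := by
    obtain ⟨hs1, hs2⟩ := hs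
    obtain ⟨ht1, ht2⟩ := ht
    have hlen := hM.2 _ hc
    rw [chordLength_coe h1 h2.le] at hlen
    rcases le_total t (s + 1 / 2) with hst | hst
    · rw [chordLength_coe (by linarith) hst] at hlen
      exact .inr (.inr (.inl (inArc_coe ⟨by linarith, by linarith⟩ ⟨by linarith, by linarith⟩)))
    · rw [chordLength_coe_of_half_le hst (by linarith)] at hlen
      rw [show t = x + 1 by linarith, coe_add_one]
      exact .inl (inArc_coe ⟨by linarith, by linarith⟩ ⟨by linarith, by linarith⟩)
  induction c using Sym2.ind with | _ p q =>
  rcases side (Sym2.mem_mk_left p q) with ⟨s, hs, rfl⟩ | ⟨s, hs, rfl⟩ <;>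
  rcases side (Sym2.mem_mk_right _ q) with ⟨t, ht, rfl⟩ | ⟨t, ht, rfl⟩
  · exact .inr (.inl (inArc_coe hs ht))
  · exact across hs ht hc
  · rw [Sym2.eq_swap] at hc ⊢
    exact across ht hs hc
  · exact .inr (.inr (.inr (inArc_coe hs ht)))

/-- Let the leaf `c` lie behind the minor, with long preimage `s(x₁, y₁)`. A leaf that is not tame
with respect to this preimage joins the two sides of it within a short arc of the central strip, so
its image separates `c` from the minor. -/
theorem behind_dblChord_of_not_tame (hL : IsSiblingInvariant L) {x y x₁ y₁ : ℝ} (h1 : x + 1 / 3 ≤ y)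
    (h2 : y < x + 1 / 2) (hM : IsMajor L s((x : Circ), (y : Circ))) (hx : x₁ ≤ x) (hy : y ≤ y₁)
    (h3 : y₁ < x₁ + 1 / 2)
    (hc : s(((2 * y₁ : ℝ) : Circ), ((2 * x₁ + 1 : ℝ) : Circ)) ∈ L) {e : Chord} (he : e ∈ L)
    (ht : ¬ Tame x₁ y₁ e) :
    (InArc y (x + 1 / 2) e ∨ InArc y (x + 1 / 2) (sibling e)) ∧
    InArc (2 * y) (2 * x + 1) (dblChord e) ∧
      Behind s(((2 * y₁ : ℝ) : Circ), ((2 * x₁ + 1 : ℝ) : Circ)) (dblChord e) := by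
  have key {e : Chord} (he : e ∈ L) (ht : ¬ Tame x₁ y₁ e) (h : InArc y (x + 1 / 2) e) :
      InArc (2 * y) (2 * x + 1) (dblChord e) ∧
        Behind s(((2 * y₁ : ℝ) : Circ), ((2 * x₁ + 1 : ℝ) : Circ)) (dblChord e) := by
    obtain ⟨p, q, h4, h5, h6, rfl⟩ := h.exists_coe
    have hp : p ≤ y₁ := by
      by_contra! hp
      rcases le_or_gt q (x₁ + 1 / 2) with hq | hq
      · exact ht (.inr (.inl (inArc_coe ⟨by linarith, by linarith⟩ ⟨by linarith, by linarith⟩)))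
      rcases le_or_gt (x₁ + 1 / 2) p with hp' | hp'
      · exact ht (.inr (.inr (.inl
          (inArc_coe ⟨by linarith, by linarith⟩ ⟨by linarith, by linarith⟩))))
      refine hL.unlinked _ hc _ (hL.forward _ he) ?_
      rw [dblChord_coe, linked_coe_iff (u := 2 * y) (v := 2 * x + 1) (by linarith) (by linarith)
        (by linarith) (by linarith) ⟨by linarith, by linarith⟩ ⟨by linarith, by linarith⟩]
      exact .inl ⟨by linarith, by linarith, .inr (by linarith)⟩
    have hq : x₁ + 1 / 2 ≤ q := by
      by_contra! hq
      rcases le_or_gt q y₁ with hq' | hq'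
      · exact ht (.inl (inArc_coe ⟨by linarith, by linarith⟩ ⟨by linarith, by linarith⟩))
      rcases hp.eq_or_lt with rfl | hp'
      · exact ht (.inr (.inl (inArc_coe ⟨by linarith, by linarith⟩ ⟨by linarith, by linarith⟩)))
      refine hL.unlinked _ hc _ (hL.forward _ he) ?_
      rw [dblChord_coe, linked_coe_iff (u := 2 * y) (v := 2 * x + 1) (by linarith) (by linarith)
        (by linarith) (by linarith) ⟨by linarith, by linarith⟩ ⟨by linarith, by linarith⟩]
      exact .inr ⟨by linarith, by linarith, .inl (by linarith)⟩
    rw [dblChord_coe]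
    refine ⟨inArc_coe ⟨by linarith, by linarith⟩ ⟨by linarith, by linarith⟩, ?_⟩
    rw [behind_coe_iff (by linarith) (by linarith)]
    exact inArc_coe ⟨by linarith, by linarith⟩ ⟨by linarith, by linarith⟩
  rcases hL.tame (by linarith) h2 hM he with h | h | h | h
  · exact absurd (.inl (h.mono hx hy)) ht
  · exact ⟨.inl h, key he ht h⟩
  · exact absurd (.inr (.inr (.inl (h.mono (by linarith) (by linarith))))) ht
  · have h' : InArc y (x + 1 / 2) (sibling e) :=
      h.sibling.sub_one.mono (by linarith) (by linarith)
    refine ⟨.inr h', ?_⟩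
    rw [← dblChord_sibling e]
    refine key (hL.sibling_mem _ he) (fun ht' => ht ?_) h'
    rw [← sibling_sibling e]
    exact ht'.sibling

/-- The dichotomy behind both halves of the theorem: a leaf behind the minor that is a pullback of
the minor through the major `M` either is a minor itself, or one of its images before `M` is a minor
that separates it from the given minor. -/
theorem mem_QML_or_exists_iterate (hL : IsSiblingInvariant L) (hM : IsMajor L M)
    (hnd : ¬ (dblChord M).IsDiag) {l : ℕ} {c : Chord} (hc : c ∈ L) (hb : Behind c (dblChord M))
    (hl : dblChord^[l] c = M) :
    c ∈ QML ∨ ∃ j, 1 ≤ j ∧ j ≤ l ∧ dblChord^[j] c ∈ QML ∧ Behind c (dblChord^[j] c) ∧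
      Behind (dblChord^[j] c) (dblChord M) := by
  induction l using Nat.strong_induction_on generalizing c with | _ l ih =>
  obtain ⟨x, y, h1, h2, hMxy⟩ := exists_lift_chord_of_lt (major_lt hnd)
  have hlen : chordLength M = y - x := by rw [hMxy, chordLength_coe h1 h2.le]
  have h13 : x + 1 / 3 ≤ y := by linarith [hL.le_major hM hnd]
  have hm : dblChord M = s(((2 * y : ℝ) : Circ), ((2 * x + 1 : ℝ) : Circ)) := by
    rw [hMxy, dblChord_coe, coe_add_one, Sym2.eq_swap]
  have hb' := hb
  rw [hm, behind_coe_iff (by linarith) (by linarith)] at hb'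
  obtain ⟨s, t, hs, hst, ht, hcst⟩ := hb'.exists_coe
  have hne : s ≠ t := by
    rintro rfl
    obtain ⟨q, hq⟩ := dblChord_iterate_diag l (s : Circ)
    rw [← hcst, hl] at hq
    exact hnd (by rw [hq]; rfl)
  have hst' : s < t := lt_of_le_of_ne hst hne
  obtain ⟨y₁, rfl⟩ : ∃ y₁, s = 2 * y₁ := ⟨s / 2, by ring⟩
  obtain ⟨x₁, rfl⟩ : ∃ x₁, t = 2 * x₁ + 1 := ⟨(t - 1) / 2, by ring⟩
  have hcxy : c = s(((2 * x₁ : ℝ) : Circ), ((2 * y₁ : ℝ) : Circ)) := by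
    rw [hcst, coe_add_one, Sym2.eq_swap]
  by_cases htame : ∀ n, Tame x₁ y₁ (dblChord^[n] c)
  · left
    rw [hcxy] at hc htame ⊢
    exact mem_QML_of_tame (by linarith) (by linarith) htame
      fun n k => hL.unlinked _ (hL.iterate_mem hc n) _ (hL.iterate_mem hc k)
  right
  push Not at htame
  obtain ⟨n, hn⟩ := htame
  obtain ⟨hshort, hbm, hcb⟩ := hL.behind_dblChord_of_not_tame h13 h2 (hMxy ▸ hM) (by linarith)
    (by linarith) (by linarith) (hcst ▸ hc) (hL.iterate_mem hc n) hn
  rw [← hcst, ← Function.iterate_succ_apply' dblChord] at hcb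
  rw [← Function.iterate_succ_apply' dblChord, ← behind_coe_iff (by linarith) (by linarith),
    ← hm] at hbm
  -- The leaf in the central strip is shorter than the minor, so it precedes `M` in the orbit.
  have hnl : n < l := by
    by_contra! hln
    have h4 := hL.chordLength_minor_le_iterate hM hnd (n - l)
    rw [← hl, ← Function.iterate_add_apply, Nat.sub_add_cancel hln] at h4
    have h5 : chordLength (dblChord^[n] c) ≤ x + 1 / 2 - y := by
      have key {e : Chord} (h : InArc y (x + 1 / 2) e) : chordLength e ≤ x + 1 / 2 - y := by
        obtain ⟨p, q, h6, h7, h8, rfl⟩ := h.exists_coe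
        rw [chordLength_coe h7 (by linarith)]
        linarith
      rcases hshort with h | h
      · exact key h
      · rw [← chordLength_sibling]
        exact key h
    rw [hl] at h4
    linarith
  have hl' : dblChord^[l - (n + 1)] (dblChord^[n + 1] c) = M := by
    rw [← Function.iterate_add_apply, Nat.sub_add_cancel hnl, hl]
  rcases ih (l - (n + 1)) (by omega) (hL.iterate_mem hc (n + 1)) hbm hl' with
    h | ⟨j, hj1, hj2, hj3, hj4, hj5⟩
  · exact ⟨n + 1, by omega, hnl, h, hcb, hbm⟩
  · rw [← Function.iterate_add_apply] at hj3 hj4 hj5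
    refine ⟨j + (n + 1), by omega, by omega, hj3, fun p hp => ?_, hj5⟩
    have hlt : chordLength (dblChord^[j + (n + 1)] c) < 1 / 2 := by
      by_contra! h
      have := hM.2 _ (hL.iterate_mem hc (j + (n + 1)))
      linarith
    exact hj4.closedArc_subset hlt (hcb p hp)

/-- The images of a pullback `c` of the minor through `M` that follow `M` do not come back behind
the minor. -/
theorem le_of_mem_openArc (hL : IsSiblingInvariant L) (hM : IsMajor L M)
    (hnd : ¬ (dblChord M).IsDiag) {l k : ℕ} {c : Chord} (hc : c ∈ L) (hl : dblChord^[l] c = M)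
    {p : Circ} (hp : p ∈ openArc (dblChord M)) (hpk : p ∈ dblChord^[k] c) : k ≤ l := by
  by_contra! hk
  have hlen := hL.chordLength_minor_le_iterate hM hnd (k - l)
  rw [← hl, ← Function.iterate_add_apply, Nat.sub_add_cancel hk.le, hl,
    ← hL.chordLength_minor hM hnd] at hlen
  have hlt := hL.chordLength_minor_lt hM hnd
  have hb := behind_of_mem_openArc hlt
    (hL.unlinked _ (hL.forward _ hM.1) _ (hL.iterate_mem hc k)) hpk hp
  rw [eq_of_behind hlt hb hlen] at hpk
  exact hp.2 hpk

/-- An end of `c` behind the minor whose orbit does not meet the minor before time `l + 1` is not an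
end of any later image of `c`: otherwise its orbit under some iterate of `σ₂` would stay behind the
minor forever. -/
theorem not_mem_iterate (hL : IsSiblingInvariant L) (hM : IsMajor L M)
    (hnd : ¬ (dblChord M).IsDiag) {l j : ℕ} {c : Chord} (hc : c ∈ L) (hl : dblChord^[l] c = M)
    {a : Circ} (ha : a ∈ openArc (dblChord M)) (hac : a ∈ c)
    (hmin : ∀ k ≤ l, dbl^[k] a ∉ dblChord M) (hj : 1 ≤ j) : a ∉ dblChord^[j] c := by
  intro haj
  have hlt := hL.chordLength_minor_lt hM hnd
  have hbig : l < j * (l + 1) := by nlinarith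
  obtain ⟨d, rfl⟩ := hac
  have hmap : dblChord^[j] s(a, d) = s(dbl^[j] a, dbl^[j] d) := by
    clear haj hbig hj
    induction j with
    | zero => rfl
    | succ j ih =>
      rw [Function.iterate_succ_apply', ih, Function.iterate_succ_apply' dbl,
        Function.iterate_succ_apply' dbl]
      rfl
  rw [hmap] at haj
  rcases Sym2.mem_iff.1 haj with h | h
  · have hper : dbl^[j * (l + 1)] a = a := by
      rw [Function.iterate_mul]
      exact Function.iterate_fixed h.symm _
    have := mem_dblChord_iterate (Sym2.mem_mk_left a d) (j * (l + 1))
    rw [hper] at this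
    exact absurd (hL.le_of_mem_openArc hM hnd hc hl ha this) (by omega)
  · have hmem (i : ℕ) : dbl^[j * i] a ∈ dblChord^[j * (i + 1)] s(a, d) := by
      have := mem_dblChord_iterate (Sym2.mem_mk_right a d) (j * i + j)
      rwa [Function.iterate_add_apply dbl, ← h] at this
    have hopen (i : ℕ) : dbl^[j * i] a ∈ openArc (dblChord M) := by
      induction i with
      | zero => exact ha
      | succ i ih =>
        have hle := hL.le_of_mem_openArc hM hnd hc hl ih (hmem i)
        have hb := behind_of_mem_openArc hlt
          (hL.unlinked _ (hL.forward _ hM.1) _ (hL.iterate_mem hc (j * (i + 1)))) (hmem i) ih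
        exact ⟨hb _ (mem_dblChord_iterate (Sym2.mem_mk_left a d) _), hmin _ hle⟩
    exact absurd (hL.le_of_mem_openArc hM hnd hc hl (hopen l) (hmem l)) (by omega)

end IsSiblingInvariant

theorem chordLength_lt_of_mem_QML {m : Chord} (hm : m ∈ QML) (hnd : ¬ m.IsDiag) :
    chordLength m < 1 / 2 := by
  obtain ⟨L, hL, M, hM, rfl⟩ := hm
  exact hL.isSiblingInvariant.chordLength_minor_lt hM hnd

/-! ### Pulling back a minor along the orbit of a point behind it -/

theorem IsMajor.sibling {L : Set Chord} {M : Chord} (hL : IsSiblingInvariant L)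
    (hM : IsMajor L M) : IsMajor L (sibling M) :=
  ⟨hL.sibling_mem _ hM.1, fun c hc => (chordLength_sibling M).symm ▸ hM.2 c hc⟩

theorem mem_or_mem_sibling {c : Chord} {p : Circ} (h : dbl p ∈ dblChord c) :
    p ∈ c ∨ p ∈ sibling c := by
  obtain ⟨q, hq, hqp⟩ := Sym2.mem_map.1 h
  rcases dbl_eq_dbl_iff.1 hqp with rfl | rfl
  · exact .inl hq
  · right
    rw [← antipode_antipode p]
    exact mem_sibling hq

theorem IsQuadraticLamination.exists_pullback {L : Set Chord} (hL : IsQuadraticLamination L)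
    {n : ℕ} {p : Circ} {c : Chord} (hc : c ∈ L) (h : dbl^[n] p ∈ c) :
    ∃ c₁ ∈ L, p ∈ c₁ ∧ dblChord^[n] c₁ = c := by
  induction n generalizing c with
  | zero => exact ⟨c, hc, h, rfl⟩
  | succ n ih =>
    obtain ⟨c', hc', rfl⟩ := hL.backward c hc
    rw [Function.iterate_succ_apply'] at h
    have key {e : Chord} (he : e ∈ L) (h : dbl^[n] p ∈ e) (hd : dblChord e = dblChord c') :
        ∃ c₁ ∈ L, p ∈ c₁ ∧ dblChord^[n + 1] c₁ = dblChord c' := by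
      obtain ⟨c₁, h1, h2, rfl⟩ := ih he h
      exact ⟨c₁, h1, h2, by rw [Function.iterate_succ_apply', hd]⟩
    rcases mem_or_mem_sibling h with h | h
    · exact key hc' h rfl
    · exact key (hL.sibling_mem _ hc') h (dblChord_sibling c')

theorem exists_minor_of_iterate_mem {n : ℕ} {m : Chord} (hm : m ∈ QML) (hnd : ¬ m.IsDiag)
    {a : Circ} (ha : a ∈ closedArc m) (hn : dbl^[n] a ∈ m) :
    ∃ m₁ ∈ QML, a ∈ m₁ ∧ ∃ k : ℕ, dblChord^[k] m₁ = m := by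
  induction n using Nat.strong_induction_on generalizing m with | _ n ih =>
  by_cases ham : a ∈ m
  · exact ⟨m, hm, ham, 0, rfl⟩
  cases n with
  | zero => exact absurd hn ham
  | succ n =>
  have hlt := chordLength_lt_of_mem_QML hm hnd
  obtain ⟨L, hL, M, hM, rfl⟩ := hm
  have hL' := hL.isSiblingInvariant
  obtain ⟨M', hM', hMM', haM'⟩ :
      ∃ M', IsMajor L M' ∧ dblChord M' = dblChord M ∧ dbl^[n] a ∈ M' := by
    rw [Function.iterate_succ_apply'] at hn
    rcases mem_or_mem_sibling hn with h | h
    · exact ⟨M, hM, rfl, h⟩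
    · exact ⟨sibling M, hM.sibling hL', dblChord_sibling M, h⟩
  rw [← hMM'] at hlt hnd ha ham ⊢
  obtain ⟨c, hc, hac, hcM⟩ := hL.exists_pullback hM'.1 haM'
  have hb := behind_of_mem_openArc hlt (hL.unlinked _ (hL.forward _ hM'.1) _ hc) hac ⟨ha, ham⟩
  rcases hL'.mem_QML_or_exists_iterate hM' hnd hc hb hcM with h | ⟨j, hj1, hj2, hj3, hj4, -⟩
  · exact ⟨c, h, hac, n + 1, by rw [Function.iterate_succ_apply', hcM]⟩
  · have hcm : dblChord^[n + 1 - j] (dblChord^[j] c) = dblChord M' := by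
      rw [← Function.iterate_add_apply, Nat.sub_add_cancel (by omega),
        Function.iterate_succ_apply', hcM]
    have hnd' : ¬ (dblChord^[j] c).IsDiag := by
      intro hd
      generalize dblChord^[j] c = e at hd hcm
      induction e using Sym2.ind with | _ p q =>
      obtain rfl : p = q := hd
      obtain ⟨r, hr⟩ := dblChord_iterate_diag (n + 1 - j) p
      exact hnd (by rw [← hcm, hr]; rfl)
    obtain ⟨m₁, h1, h2, k, h3⟩ := ih j (by omega) hj3 hnd' (hj4 a hac)
      (mem_dblChord_iterate hac j)
    exact ⟨m₁, h1, h2, n + 1 - j + k, by rw [Function.iterate_add_apply, h3, hcm]⟩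

/-! ### Laminations generated by equivalence relations -/

namespace IsInvariantLaminational

variable {r : Setoid Circ}

theorem dbl_rel (hr : IsInvariantLaminational r) {p q : Circ} (h : r p q) :
    r (dbl p) (dbl q) := by
  have : dbl q ∈ dbl '' {y | r p y} := ⟨q, h, rfl⟩
  rwa [hr.image_class] at this

theorem rel_or_rel_antipode (hr : IsInvariantLaminational r) {p q : Circ}
    (h : r (dbl p) (dbl q)) : r p q ∨ r p (antipode q) := by
  have : dbl q ∈ dbl '' {y | r p y} := by rwa [hr.image_class]
  obtain ⟨w, hw, hwq⟩ := this
  rcases dbl_eq_dbl_iff.1 hwq with rfl | rfl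
  exacts [.inl hw, .inr hw]

theorem antipode_rel (hr : IsInvariantLaminational r) {p q : Circ} (h : r p q) :
    r (antipode p) (antipode q) := by
  have h1 : r (dbl (antipode p)) (dbl q) := by
    rw [dbl_antipode]
    exact hr.dbl_rel h
  have h2 : r (dbl (antipode q)) (dbl p) := by
    rw [dbl_antipode]
    exact r.symm (hr.dbl_rel h)
  rcases hr.rel_or_rel_antipode h1 with h1 | h1
  · rcases hr.rel_or_rel_antipode h2 with h2 | h2
    · exact r.trans h1 (r.trans (r.symm h) (r.symm h2))
    · exact r.symm h2
  · exact h1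

/-- Images of edges are edges. If the arc free of class points is shorter than a half-circle and its
image contains a point of the image class, then the halves of that point and the antipodes of the
ends form two linked classes. If it is longer, the whole class lies in an arc shorter than a
half-circle, which `σ₂` maps injectively. -/
theorem dblChord_mem (hr : IsInvariantLaminational r) {c : Chord} (hc : c ∈ laminationOf r) :
    dblChord c ∈ laminationOf r := by
  obtain ⟨p, q, rfl, hpq, h⟩ := hc
  by_cases hd : dbl p = dbl q
  · exact ⟨dbl p, dbl q, rfl, hr.dbl_rel hpq, .inl hd⟩
  have hne : p ≠ q := fun h => hd (h ▸ rfl)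
  replace h := h.resolve_left hne
  have hdpq := hr.dbl_rel hpq
  obtain ⟨x, -, -, rfl⟩ := exists_lift 0 p
  obtain ⟨y, hxy, hyx, rfl⟩ := exists_lift x q
  have hxy' : x < y := hxy.lt_of_ne fun h => hne (by rw [h])
  rcases le_or_gt y (x + 1 / 2) with hlen | hlen
  · have hlen' : y < x + 1 / 2 := hlen.lt_of_ne fun h => hd (by
      rw [dbl_coe, dbl_coe, h, show 2 * (x + 1 / 2) = 2 * x + 1 by ring, coe_add_one])
    refine ⟨dbl x, dbl y, rfl, hdpq, .inr fun z' hz' hs => ?_⟩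
    obtain ⟨s, -, -, rfl⟩ := exists_lift 0 z'
    rw [dbl_coe, dbl_coe, sbtw_coe (by linarith) (by linarith)] at hs
    obtain ⟨n, hn1, hn2⟩ := hs
    obtain ⟨z, hz⟩ : ∃ z : ℝ, s + n = 2 * z := ⟨(s + n) / 2, by ring⟩
    have hzs : dbl (z : Circ) = s := by rw [dbl_coe, ← hz, coe_add_int]
    rw [← hzs] at hz'
    have hxz : ¬ r (x : Circ) z := fun h' =>
      h z h' ((sbtw_coe hxy hyx).2 ⟨0, by push_cast; linarith, by push_cast; linarith⟩)
    have hxz' := (hr.rel_or_rel_antipode hz').resolve_left hxz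
    have hzy : r (z : Circ) (antipode y) := by
      have : r (dbl (z : Circ)) (dbl (y : Circ)) := r.trans (r.symm hz') hdpq
      exact (hr.rel_or_rel_antipode this).resolve_left
        fun h' => hxz (r.trans hpq (r.symm h'))
    refine hr.unlinked _ _ _ _ hxz' hzy hxz ?_
    rw [antipode_coe, antipode_coe, linked_coe_iff (u := x) (v := y + 1 / 2) (by linarith)
      (by linarith) (by linarith) (by linarith) ⟨by linarith, by linarith⟩
      ⟨by linarith, by linarith⟩]
    exact .inl ⟨by linarith, by linarith, .inr (by linarith)⟩
  · refine ⟨dbl x, dbl y, rfl, hdpq, .inr fun z' hz' hs => ?_⟩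
    have : z' ∈ dbl '' {w | r (x : Circ) w} := by rwa [hr.image_class]
    obtain ⟨w, hw, rfl⟩ := this
    obtain ⟨z, hz1, hz2, rfl⟩ := exists_lift y w
    have hzx : z ≤ x + 1 := by
      by_contra! hzx
      exact h _ hw ((sbtw_coe hxy hyx).2 ⟨-1, by push_cast; linarith, by push_cast; linarith⟩)
    rw [dbl_coe, dbl_coe, dbl_coe, ← coe_add_one (2 * x),
      sbtw_coe (by linarith) (by linarith)] at hs
    obtain ⟨n, hn1, hn2⟩ := hs
    have h3 : ((-1 : ℤ) : ℝ) < n := by push_cast; linarith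
    have h4 : (n : ℝ) < (0 : ℤ) := by push_cast; linarith
    have h3' := Int.cast_lt.1 h3
    have h4' := Int.cast_lt.1 h4
    omega

theorem isSiblingInvariant (hr : IsInvariantLaminational r) :
    IsSiblingInvariant (laminationOf r) where
  unlinked := by
    rintro _ ⟨p, q, rfl, hpq, h⟩ _ ⟨s, t, rfl, hst, -⟩ hl
    by_cases hps : r p s
    · rcases h with rfl | h
      · exact not_linked_diag_left _ _ hl
      · rcases linked_mk.1 hl with ⟨h1, -⟩ | ⟨h1, -⟩
        · exact h s hps h1
        · exact h t (r.trans hps hst) h1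
    · exact hr.unlinked _ _ _ _ hpq hst hps hl
  forward _ hc := hr.dblChord_mem hc
  sibling_mem := by
    rintro _ ⟨p, q, rfl, hpq, h⟩
    refine ⟨antipode p, antipode q, rfl, hr.antipode_rel hpq,
      h.imp (congrArg _) fun h z hz hs => ?_⟩
    rw [← antipode_antipode z, sbtw_antipode] at hs
    refine h _ ?_ hs
    rw [← antipode_antipode p]
    exact hr.antipode_rel hz

end IsInvariantLaminational

theorem IsMinorLeafLamination.isSiblingInvariant {m : Chord} {L : Set Chord}
    (h : IsMinorLeafLamination m L) : IsSiblingInvariant L := by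
  rcases h with ⟨-, h, -⟩ | ⟨-, ⟨r, hr, rfl⟩, -⟩
  · exact h.1.isSiblingInvariant
  · exact hr.isSiblingInvariant

/-! ### Offsprings -/

theorem IsOffspring.mem_QML {m c : Chord} (hm : m ∈ QML) (hnd : ¬ m.IsDiag)
    (h : IsOffspring m c) : c ∈ QML := by
  obtain ⟨a, -, -, l, m', L, hleast, hhit, hL, hc, hac, hcm, hM⟩ := h
  have hL := hL.isSiblingInvariant
  have hmM : dblChord (dblChord^[l] c) = m' := by
    rw [← Function.iterate_succ_apply' dblChord, hcm]
  have hmin (k : ℕ) (hk : k ≤ l) (m'' : Chord) : ¬ IsHitMinor m a k m'' := fun h => by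
    have := hleast.2 ⟨m'', h⟩
    omega
  obtain ⟨hm', ham', hbm', -⟩ := hhit
  have hnd' : ¬ m'.IsDiag := by
    intro hd
    induction m' using Sym2.ind with | _ p q =>
    obtain rfl : p = q := hd
    obtain ⟨t, -, -, rfl⟩ := exists_lift 0 p
    obtain ⟨s, ⟨h1, h2⟩, hs⟩ := (mem_closedArc_coe le_rfl (by linarith)).1 ham'.1
    refine ham'.2 (hs ▸ ?_)
    rw [le_antisymm h2 h1]
    exact Sym2.mem_mk_left _ _
  rw [← hmM] at hm' ham' hbm' hnd'
  have hlt := hL.chordLength_minor_lt hM hnd'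
  have hb := behind_of_mem_openArc hlt (hL.unlinked _ (hL.forward _ hM.1) _ hc) hac ham'
  rcases hL.mem_QML_or_exists_iterate hM hnd' hc hb rfl with h | ⟨j, hj1, hj2, hj3, hj4, hj5⟩
  · exact h
  have haj : a ∉ dblChord^[j] c := hL.not_mem_iterate hM hnd' hc rfl ham' hac
    (fun k hk h => hmin k hk _ ⟨hm', ham', hbm', h⟩) hj1
  refine absurd ⟨hj3, ⟨hj4 a hac, haj⟩, fun p hp => ?_, mem_dblChord_iterate hac j⟩ (hmin j hj2 _)
  exact hbm'.closedArc_subset (chordLength_lt_of_mem_QML hm hnd) (hj5 p hp)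

end QuadLam

theorem theoremA (m : QuadLam.Chord) (hm : m ∈ QuadLam.QML) (hnd : ¬ m.IsDiag) :
    (∀ m₁ : QuadLam.Chord, QuadLam.IsOffspring m m₁ → m₁ ∈ QuadLam.QML) ∧
    (∀ a : QuadLam.Circ, a ∈ QuadLam.closedArc m → (∃ n : ℕ, QuadLam.dbl^[n] a ∈ m) →
      ∃ m₁ ∈ QuadLam.QML, a ∈ m₁ ∧ ∃ k : ℕ, QuadLam.dblChord^[k] m₁ = m) :=
  ⟨fun _ h => h.mem_QML hm hnd,
    fun _ ha ⟨_, hn⟩ => QuadLam.exists_minor_of_iterate_mem hm hnd ha hn⟩
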